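/- Call a binary relation $\preceq$ on a group $G$ a \emph{p-order} if 1. $g\preceq h$ and $h\preceq g$ imply $g=h$ (for all $g,h\in G$); 2. $1\preceq g$ implies $g^{-1}\preceq 1$; 3. $1\preceq g$ implies $1\preceq g^{n}$ for every $n\in\mathbb{N}$; 4. for every $g\in G$, $1\preceq g$ or $1\preceq g^{-1}$. (Every left-invariant linear order, in particular every bi-invariant one, is a p-order.) A p-order $\preceq$ on a countable group $G$ is \emph{computable} if $G$ has a generating sequence $X=(x_0,x_1,x_2,\dots)$ (repetitions allowed, so finite generating sets are included) such that the set of pairs $(u,v)$ of words in the letters $x_i^{\pm1}$ for which the elements of $G$ represented by $u$ and $v$ satisfy $u\preceq v$ is recursive. A group is \emph{bi-orderable} if it admits a linear order invariant under left and right multiplication. **Theorem.** There exists a two-generated bi-orderable group $G$ with decidable word problem (that is, for some generators $a,b$ of $G$ the set of words in $a^{\pm1},b^{\pm1}$ that represent $1$ is recursive) which is solvable of derived length exactly $3$ and which does not embed in any countable group that has a computable p-order. -/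

import Mathlib

/-- The element of `G` represented by a word in the letters `x i` (written `(i, true)`) and
`(x i)⁻¹` (written `(i, false)`). -/
def wordVal {ι G : Type*} [Group G] (x : ι → G) (w : List (ι × Bool)) : G :=
  (w.map fun p => cond p.2 (x p.1) (x p.1)⁻¹).prod

/-- `G` is a computable group with respect to the generating family `x`: the family generates `G`
and the set of words that represent `1` is recursive.  For a finite `ι` this says that `G` is
finitely generated with decidable word problem. -/
def IsComputableGroupWith {ι G : Type*} [Primcodable ι] [Group G] (x : ι → G) : Prop :=
  Subgroup.closure (Set.range x) = ⊤ ∧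
    ComputablePred fun w : List (ι × Bool) => wordVal x w = 1

/-- There is a linear order on `G` that is invariant under left and right multiplication. -/
def IsBiorderable (G : Type*) [Group G] : Prop :=
  ∃ _ : LinearOrder G, ∀ a b c : G, a ≤ b → c * a ≤ c * b ∧ a * c ≤ b * c

/-- The group `G` is solvable of derived length exactly `n`. -/
def HasDerivedLength (G : Type*) [Group G] (n : ℕ) : Prop :=
  derivedSeries G n = ⊥ ∧ ∀ m < n, derivedSeries G m ≠ ⊥

/-- p-orders on a group.  Neither transitivity nor comparability of arbitrary pairs is required.
The clause `one_le_or_one_le_inv` (every element or its inverse is nonnegative) is the part of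
the linearity of left orders that is kept. -/
structure IsPOrder {G : Type*} [Group G] (r : G → G → Prop) : Prop where
  antisymm : ∀ g h : G, r g h → r h g → g = h
  inv_le_one : ∀ g : G, r 1 g → r g⁻¹ 1
  one_le_pow : ∀ (g : G) (n : ℕ), r 1 g → r 1 (g ^ n)
  one_le_or_one_le_inv : ∀ g : G, r 1 g ∨ r 1 g⁻¹

/-- The relation `r` on `G` is computable with respect to the generating family `x`: the family
generates `G` and the set of pairs of words `(u, v)` with `u ≼ v` in `G` is recursive. -/
def IsComputableRelWith {ι G : Type*} [Primcodable ι] [Group G] (x : ι → G)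
    (r : G → G → Prop) : Prop :=
  Subgroup.closure (Set.range x) = ⊤ ∧
    ComputablePred fun p : List (ι × Bool) × List (ι × Bool) =>
      r (wordVal x p.1) (wordVal x p.2)

/-- `G` carries a p-order that is computable with respect to some sequence `x 0, x 1, …` of
generators (repetitions are allowed, so finite generating sets are included). -/
def HasComputablePOrder (G : Type*) [Group G] : Prop :=
  ∃ (r : G → G → Prop) (x : ℕ → G), IsPOrder r ∧ IsComputableRelWith x r

/-! In P. Hall's centre-by-metabelian group on `x` and `t`, the central elements `⁅x, t ^ k * x * t
^ (-k)⁆` can be prescribed to be any sequence `d k` with `d 0 = 0` in an abelian group. The sequence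
`comm` encodes two disjoint, recursively inseparable r.e. sets. If `n` is never enumerated, `d
(2n+1)` and `d (2n+2)` are independent; if it enters the first or second set at stage `s`, then `d
(2n+2)` is `s + 1` or `-(s + 1)` times `d (2n+1)`.

A p-order on an overgroup gives each nontrivial `d k` a sign, compatible with powers and inverses.
The signs of `d (2n+1)` and `d (2n+2)` agree on the first set and differ on the second, so a
computable p-order would separate the two sets recursively
(`not_exists_injective_of_hasComputablePOrder`).

The word problem stays decidable because the multiplier grows with the stage: a relation `p * d
(2n+1) + q * d (2n+2) = 0` with `q ≠ 0` forces `s + 1 ≤ |p|`, so a bounded search suffices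
(`coordVanish_iff`). The bi-order is lexicographic (`isBiorderable`). -/

open LaurentPolynomial commutatorElement

/-! ### Hall's group: construction, commutators, derived series, bi-order. -/

namespace HallGroup

section Pairing

variable {A : Type*} [AddCommGroup A]

/-- The additive extension of `T k ↦ d k` to Laurent polynomials, where `d` is extended to negative
indices by the value `d 0`. -/
noncomputable def pairing (d : ℕ → A) : ℤ[T;T⁻¹] →+ A where
  toFun p := p.coeff.sum fun k a => a • d k.toNat
  map_zero' := by rw [AddMonoidAlgebra.coeff_zero, Finsupp.sum_zero_index]
  map_add' p q := by
    rw [AddMonoidAlgebra.coeff_add, Finsupp.sum_add_index'] <;> intros <;> simp [add_smul]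

theorem pairing_T (d : ℕ → A) (k : ℤ) : pairing d (T k) = d k.toNat := by
  change (Finsupp.single k 1).sum (fun k (a : ℤ) => a • d k.toNat) = _
  simp

end Pairing

end HallGroup

/-- The triples underlying P. Hall's centre-by-metabelian group with commutator sequence `d`. -/
@[ext]
structure HallGroup {A : Type*} [AddCommGroup A] (d : ℕ → A) where
  shift : ℤ
  poly : ℤ[T;T⁻¹]
  center : A

namespace HallGroup

variable {A : Type*} [AddCommGroup A] {d : ℕ → A}

/-- The last summand is a 2-cocycle. Inverting the left polynomial makes the pairing invariant under
a common shift of both arguments, which is what associativity needs. -/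
noncomputable instance : Mul (HallGroup d) where
  mul g h := ⟨g.shift + h.shift, g.poly + T g.shift * h.poly,
    g.center + h.center + pairing d (invert g.poly * (T g.shift * h.poly))⟩

noncomputable instance : One (HallGroup d) := ⟨⟨0, 0, 0⟩⟩

noncomputable instance : Inv (HallGroup d) where
  inv g := ⟨-g.shift, -(T (-g.shift) * g.poly),
    -g.center + pairing d (invert g.poly * g.poly)⟩

@[simp] theorem one_shift : (1 : HallGroup d).shift = 0 := rfl
@[simp] theorem one_poly : (1 : HallGroup d).poly = 0 := rfl
@[simp] theorem one_center : (1 : HallGroup d).center = 0 := rfl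
@[simp] theorem mul_shift (g h : HallGroup d) : (g * h).shift = g.shift + h.shift := rfl
@[simp] theorem mul_poly (g h : HallGroup d) :
    (g * h).poly = g.poly + T g.shift * h.poly := rfl
@[simp] theorem mul_center (g h : HallGroup d) : (g * h).center =
    g.center + h.center + pairing d (invert g.poly * (T g.shift * h.poly)) := rfl
@[simp] theorem inv_shift (g : HallGroup d) : g⁻¹.shift = -g.shift := rfl
@[simp] theorem inv_poly (g : HallGroup d) : g⁻¹.poly = -(T (-g.shift) * g.poly) := rfl
@[simp] theorem inv_center (g : HallGroup d) :
    g⁻¹.center = -g.center + pairing d (invert g.poly * g.poly) := rfl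

theorem T_neg_mul_T (m : ℤ) : (T (-m) * T m : ℤ[T;T⁻¹]) = 1 := by
  rw [← T_add]; simp

noncomputable instance : Group (HallGroup d) :=
  Group.ofLeftAxioms
    (fun a b c => by
      have h := T_neg_mul_T a.shift
      ext1
      · simp [add_assoc]
      · simp only [mul_shift, mul_poly, T_add]; ring
      · simp only [mul_shift, mul_poly, mul_center, T_add, map_add, map_mul, invert_T]
        have e : (invert a.poly + T (-a.shift) * invert b.poly) *
            (T a.shift * T b.shift * c.poly) =
            invert a.poly * (T a.shift * (T b.shift * c.poly)) +
              invert b.poly * (T b.shift * c.poly) := by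
          linear_combination (invert b.poly * T b.shift * c.poly) * h
        rw [e, mul_add, mul_add, map_add, map_add]
        abel)
    (fun a => by ext1 <;> simp)
    (fun a => by
      have h := T_neg_mul_T a.shift
      ext1
      · simp
      · simp
      · simp only [mul_center, inv_shift, inv_poly, inv_center, map_neg, map_mul, invert_T,
          neg_neg, one_center]
        have e : -(T a.shift * invert a.poly) * (T (-a.shift) * a.poly) =
            -(invert a.poly * a.poly) := by
          linear_combination -(invert a.poly * a.poly) * h
        rw [e, map_neg]
        abel)

/-- The inclusion of `A` into the centre. -/
noncomputable def incl (d : ℕ → A) : Multiplicative A →* HallGroup d where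
  toFun a := ⟨0, 0, a.toAdd⟩
  map_one' := rfl
  map_mul' a b := by ext1 <;> simp

@[simp] theorem incl_shift (a : Multiplicative A) : (incl d a).shift = 0 := rfl
@[simp] theorem incl_poly (a : Multiplicative A) : (incl d a).poly = 0 := rfl
@[simp] theorem incl_center (a : Multiplicative A) : (incl d a).center = a.toAdd := rfl

theorem incl_injective : Function.Injective (incl d) := fun _ _ h =>
  congrArg HallGroup.center h

/-- The base generator `x` and the shift `t`. -/
noncomputable def gen (d : ℕ → A) : Fin 2 → HallGroup d :=
  ![⟨0, 1, 0⟩, ⟨1, 0, 0⟩]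

@[simp] theorem gen_zero : gen d 0 = ⟨0, 1, 0⟩ := rfl
@[simp] theorem gen_one : gen d 1 = ⟨1, 0, 0⟩ := rfl

theorem shift_pow (g : HallGroup d) (k : ℕ) : (g ^ k).shift = k * g.shift := by
  induction k with
  | zero => simp
  | succ k ih => rw [pow_succ, mul_shift, ih]; push_cast; ring

theorem poly_pow (g : HallGroup d) (hg : g.poly = 0) (k : ℕ) : (g ^ k).poly = 0 := by
  induction k with
  | zero => simp
  | succ k ih => rw [pow_succ, mul_poly, ih, hg]; simp

/-- Elements of shift zero form a central extension of the additive group of polynomials, so their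
commutator is the antisymmetrised cocycle. -/
theorem commutatorElement_eq_incl {g h : HallGroup d} (hg : g.shift = 0) (hh : h.shift = 0) :
    ⁅g, h⁆ = incl d (.ofAdd (pairing d (invert g.poly * h.poly) -
      pairing d (invert h.poly * g.poly))) := by
  obtain ⟨z, hz⟩ : ∃ z, pairing d (invert g.poly * h.poly) -
    pairing d (invert h.poly * g.poly) = z := ⟨_, rfl⟩
  rw [hz, commutatorElement_def, mul_inv_eq_iff_eq_mul, mul_inv_eq_iff_eq_mul]
  ext1
  · simp [hg, hh]
  · simp [hg, hh, add_comm]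
  · simp [hg, hh, sub_eq_iff_eq_add.1 hz]; abel

theorem poly_conj {g h : HallGroup d} (hg : g.shift = 0) (hh : h.poly = 0) :
    (h * g * h⁻¹).poly = T h.shift * g.poly := by
  simp [hg, hh]

theorem shift_conj (g h : HallGroup d) : (h * g * h⁻¹).shift = g.shift := by
  simp

/-- The commutator of `x` with its conjugate by `t ^ k` is the central element `d k`. -/
theorem commutatorElement_gen (h0 : d 0 = 0) (k : ℕ) :
    ⁅gen d 0, gen d 1 ^ k * gen d 0 * (gen d 1 ^ k)⁻¹⁆ = incl d (.ofAdd (d k)) := by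
  rw [commutatorElement_eq_incl rfl (by rw [shift_conj]; rfl),
    poly_conj rfl (poly_pow _ rfl k), shift_pow]
  congr 2
  -- The second pairing is taken at `T (-k)`, where it has the value `d 0 = 0`.
  simp [pairing_T, h0]

theorem derivedSeries_three : derivedSeries (HallGroup d) 3 = ⊥ := by
  have h1 : ∀ g ∈ derivedSeries (HallGroup d) 1, g.shift = 0 := by
    let φ : HallGroup d →* Multiplicative ℤ :=
      { toFun := fun g => .ofAdd g.shift
        map_one' := rfl
        map_mul' := fun _ _ => rfl }
    intro g hg
    have : g ∈ φ.ker := Abelianization.commutator_subset_ker φ (by simpa using hg)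
    exact this
  have h2 : derivedSeries (HallGroup d) 2 ≤ (incl d).range := by
    rw [derivedSeries_succ, Subgroup.commutator_le]
    intro g hg h hh
    rw [commutatorElement_eq_incl (h1 g hg) (h1 h hh)]
    exact ⟨_, rfl⟩
  rw [eq_bot_iff, derivedSeries_succ, Subgroup.commutator_le]
  intro g hg h hh
  obtain ⟨a, rfl⟩ := h2 hg
  obtain ⟨b, rfl⟩ := h2 hh
  rw [Subgroup.mem_bot, commutatorElement_eq_one_iff_mul_comm, ← map_mul, ← map_mul, mul_comm]

/-- A double commutator of `x` and `t` in the second derived subgroup. -/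
theorem commutatorElement_commutatorElement_gen (h0 : d 0 = 0) (k : ℕ) :
    ⁅⁅gen d 1, gen d 0⁆, gen d 1 ^ (k + 1) * ⁅gen d 1, gen d 0⁆ * (gen d 1 ^ (k + 1))⁻¹⁆ =
      incl d (.ofAdd (2 • d (k + 1) - d k - d (k + 2))) := by
  have hs : ⁅gen d 1, gen d 0⁆.shift = 0 := by simp [commutatorElement_def]
  have hp : ⁅gen d 1, gen d 0⁆.poly = T 1 - 1 := by
    simp [commutatorElement_def, sub_eq_add_neg]
  rw [commutatorElement_eq_incl hs (by rw [shift_conj, hs]),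
    poly_conj hs (poly_pow _ rfl _), shift_pow, hp]
  congr 2
  have e1 : (invert (T 1 - 1) * (T ((k + 1 : ℕ) * (gen d 1).shift) * (T 1 - 1)) : ℤ[T;T⁻¹]) =
      T ((k : ℤ) + 1) + T ((k : ℤ) + 1) - T (k : ℤ) - T ((k : ℤ) + 2) := by
    simp only [gen_one, map_sub, invert_T, map_one, mul_sub, sub_mul, ← T_add, one_mul,
      mul_one]
    push_cast
    ring_nf
  have e2 : (invert (T ((k + 1 : ℕ) * (gen d 1).shift) * (T 1 - 1)) * (T 1 - 1) : ℤ[T;T⁻¹]) =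
      T (-((k : ℤ) + 1)) + T (-((k : ℤ) + 1)) - T (-(k : ℤ)) - T (-((k : ℤ) + 2)) := by
    simp only [gen_one, map_sub, invert_T, mul_sub, sub_mul, ← T_add, mul_one]
    push_cast
    ring_nf
  have z : ∀ m : ℕ, (-(m : ℤ)).toNat = 0 := by intro m; omega
  have z1 : (-((k : ℤ) + 1)).toNat = 0 := by omega
  have z2 : (-((k : ℤ) + 2)).toNat = 0 := by omega
  have z3 : ((k : ℤ) + 1).toNat = k + 1 := by omega
  have z4 : ((k : ℤ) + 2).toNat = k + 2 := by omega
  rw [e1, e2]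
  simp only [map_add, map_sub, pairing_T, z, z1, z2, z3, z4, h0, Int.toNat_natCast]
  abel

theorem coeff_T_mul (m : ℤ) (p : ℤ[T;T⁻¹]) (j : ℤ) : (T m * p).coeff j = p.coeff (j - m) := by
  rw [T, AddMonoidAlgebra.coeff_single_mul_apply, one_mul, neg_add_eq_sub]

/-- Compare shifts, then polynomials, then central parts. Multiplication by `T m` translates
exponents and so keeps the lexicographic order. The cocycle matters only when shifts and polynomials
agree, and then it is the same on both sides. -/
theorem isBiorderable [LinearOrder A] [IsOrderedAddMonoid A] : IsBiorderable (HallGroup d) := by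
  let key : HallGroup d → ℤ ×ₗ (Lex (ℤ →₀ ℤ)) ×ₗ A := fun g =>
    toLex (g.shift, toLex (toLex g.poly.coeff, g.center))
  have key_inj : Function.Injective key := fun g h e => by
    simp only [key, EmbeddingLike.apply_eq_iff_eq, Prod.mk.injEq,
      AddMonoidAlgebra.coeff_inj] at e
    exact HallGroup.ext e.1 e.2.1 e.2.2
  let _ : LinearOrder (HallGroup d) := LinearOrder.lift' key key_inj
  have le_iff (g h : HallGroup d) : g ≤ h ↔ g.shift < h.shift ∨ g.shift = h.shift ∧
      (toLex g.poly.coeff < toLex h.poly.coeff ∨ g.poly = h.poly ∧ g.center ≤ h.center) := by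
    change key g ≤ key h ↔ _
    simp [key, Prod.Lex.le_iff]
  have T_mul_lt (m : ℤ) (p q : ℤ[T;T⁻¹]) (h : toLex p.coeff < toLex q.coeff) :
      toLex (T m * p).coeff < toLex (T m * q).coeff := by
    rw [Finsupp.Lex.lt_iff] at h ⊢
    obtain ⟨i, hi, hlt⟩ := h
    refine ⟨i + m, fun j hj => ?_, ?_⟩
    · simpa only [ofLex_toLex, coeff_T_mul] using hi (j - m) (by linarith)
    · simpa only [ofLex_toLex, coeff_T_mul, add_sub_cancel_right] using hlt
  refine ⟨inferInstance, fun a b c hab => ?_⟩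
  rw [le_iff] at hab
  rw [le_iff, le_iff]
  simp only [mul_shift, mul_poly, mul_center]
  rcases hab with h | ⟨h, h' | ⟨h', h''⟩⟩
  · exact ⟨.inl (by linarith), .inl (by linarith)⟩
  · rw [h]
    refine ⟨.inr ⟨rfl, .inl ?_⟩, .inr ⟨rfl, .inl ?_⟩⟩
    · rw [AddMonoidAlgebra.coeff_add, AddMonoidAlgebra.coeff_add, toLex_add, toLex_add]
      exact add_lt_add_right (T_mul_lt _ _ _ h') _
    · rw [AddMonoidAlgebra.coeff_add, AddMonoidAlgebra.coeff_add, toLex_add, toLex_add]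
      exact add_lt_add_left h' _
  · rw [h, h']
    exact ⟨.inr ⟨rfl, .inr ⟨rfl, by gcongr⟩⟩, .inr ⟨rfl, .inr ⟨rfl, by gcongr⟩⟩⟩

end HallGroup

/-! ### Recursively inseparable sets. -/

/-- A primitive recursive enumeration of two disjoint sets of natural numbers, given by the stage at
which a number is put into the first (`some true`) or second (`some false`) set, whose two sets are
recursively inseparable. -/
structure IsInseparableEnumeration (stage : ℕ → ℕ → Option Bool) : Prop where
  primrec : Primrec₂ stage
  unique : ∀ {n s s'}, stage n s ≠ none → stage n s' ≠ none → s = s'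
  inseparable : ∀ f : ℕ → Bool, Computable f → ∃ n s, stage n s = some (!f n)

/-- Diagonalisation: run program `n` on input `n` and sort `n` by whether the output is `0`. A
program that outputs `1` or `0` according to a proposed separator `f` is misplaced by `f` at its own
code. -/
theorem exists_isInseparableEnumeration : ∃ stage, IsInseparableEnumeration stage := by
  let out : ℕ → ℕ → Option ℕ := fun n s =>
    Nat.Partrec.Code.evaln s (Denumerable.ofNat Nat.Partrec.Code n) n
  have out_mono {n s s' y} (hs : s ≤ s') (h : out n s = some y) : out n s' = some y :=
    Nat.Partrec.Code.evaln_mono hs h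
  have hout : Primrec₂ out :=
    Nat.Partrec.Code.primrec_evaln.comp
      ((Primrec.snd.pair ((Primrec.ofNat _).comp Primrec.fst)).pair Primrec.fst)
  let stage : ℕ → ℕ → Option Bool := fun n s =>
    bif (out n s).isSome then none else (out n (s + 1)).map fun y => y == 0
  have stage_ne {n s} (h : stage n s ≠ none) : out n s = none ∧ ∃ y, out n (s + 1) = some y := by
    simp only [stage] at h
    cases h1 : out n s <;> cases h2 : out n (s + 1) <;> simp_all
  have lt_of_stage {n s s'} (h : stage n s ≠ none) (h' : stage n s' ≠ none) : s ≤ s' := by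
    by_contra! hlt
    obtain ⟨y, hy⟩ := (stage_ne h').2
    have := out_mono hlt hy
    rw [(stage_ne h).1] at this
    cases this
  refine ⟨stage, ?_, fun h h' => le_antisymm (lt_of_stage h h') (lt_of_stage h' h), fun f hf => ?_⟩
  · refine Primrec.cond (Primrec.option_isSome.comp hout) (Primrec.const none)
      (Primrec.option_map (hout.comp Primrec.fst (Primrec.succ.comp Primrec.snd)) ?_)
    exact Primrec.beq.comp Primrec.snd (Primrec.const 0)
  · have hg : Computable fun n => bif f n then 1 else 0 :=
      Computable.cond hf (Computable.const 1) (Computable.const 0)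
    obtain ⟨c, hc⟩ := Nat.Partrec.Code.exists_code.1 (Partrec.nat_iff.1 hg)
    let n := Encodable.encode c
    have hex : ∃ s, out n s = some (bif f n then 1 else 0) := by
      have : (bif f n then 1 else 0) ∈ c.eval n := by rw [hc]; exact Part.mem_some _
      obtain ⟨s, hs⟩ := Nat.Partrec.Code.evaln_complete.1 this
      exact ⟨s, by simpa [out, n] using hs⟩
    classical
    -- No program halts with step bound `0`, so the first halting bound is a successor.
    obtain ⟨s, hs⟩ : ∃ s, Nat.find hex = s + 1 := by
      refine Nat.exists_eq_succ_of_ne_zero fun h0 => ?_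
      have := Nat.find_spec hex
      rw [h0] at this
      simp [out, Nat.Partrec.Code.evaln] at this
    have h1 : out n (s + 1) = some (bif f n then 1 else 0) := hs ▸ Nat.find_spec hex
    have h2 : out n s = none := by
      cases h : out n s with
      | none => rfl
      | some y =>
        have h' := out_mono (Nat.le_succ s) h
        rw [h1] at h'
        exact absurd (h.trans h'.symm) (Nat.find_min hex (by omega))
    refine ⟨n, s, ?_⟩
    cases hfn : f n <;> simp [stage, h1, h2, hfn]

/-! ### Symbolic evaluation of words and a primitive recursive triviality test. -/

theorem primrec_list_count {α : Type*} [Primcodable α] [BEq α] [LawfulBEq α] :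
    Primrec₂ fun (l : List α) (a : α) => l.count a := by
  classical
  refine (Primrec.list_length.comp₂
    (PrimrecRel.listFilter (R := fun a b : α => a = b) Primrec.eq)).of_eq fun l a => ?_
  rw [List.count, List.countP_eq_length_filter]
  congr 2
  ext b
  rw [Bool.eq_iff_iff]
  simp

namespace HallGroup

/-- A symbolic element: the position of the shift, the signed monomials of the polynomial part and
the signed central generators. -/
abbrev Symbol := ℕ × List (ℕ × Bool) × List (ℕ × Bool)

/-- Multiplication of a symbolic element by a letter. -/
def Symbol.step (σ : Symbol) (a : Fin 2 × Bool) : Symbol :=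
  if a.1 = 0 then
    (σ.1, (σ.1, a.2) :: σ.2.1, (σ.2.1.map fun e => (σ.1 - e.1, e.2 == a.2)) ++ σ.2.2)
  else (bif a.2 then σ.1 + 1 else σ.1 - 1, σ.2)

/-- Evaluation of a word, with the shift starting at the length of the word. -/
def Symbol.ofWord (w : List (Fin 2 × Bool)) : Symbol :=
  w.foldl Symbol.step (w.length, [], [])

theorem Symbol.primrec_ofWord : Primrec Symbol.ofWord := by
  have : Primrec₂ Symbol.step := by
    refine Primrec.ite (Primrec.eq.comp (Primrec.fst.comp Primrec.snd) (Primrec.const 0)) ?_ ?_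
    · have h1 : Primrec fun p : Symbol × (Fin 2 × Bool) => p.1.1 := Primrec.fst.comp Primrec.fst
      have h2 : Primrec fun p : Symbol × (Fin 2 × Bool) => p.1.2.1 :=
        Primrec.fst.comp (Primrec.snd.comp Primrec.fst)
      have h3 : Primrec fun p : Symbol × (Fin 2 × Bool) => p.1.2.2 :=
        Primrec.snd.comp (Primrec.snd.comp Primrec.fst)
      have h4 : Primrec fun p : Symbol × (Fin 2 × Bool) => p.2.2 := Primrec.snd.comp Primrec.snd
      refine h1.pair ((Primrec.list_cons.comp (h1.pair h4) h2).pair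
        (Primrec.list_append.comp (Primrec.list_map h2 ?_) h3))
      exact (Primrec.nat_sub.comp (h1.comp Primrec.fst) (Primrec.fst.comp Primrec.snd)).pair
        (Primrec.beq.comp (Primrec.snd.comp Primrec.snd) (h4.comp Primrec.fst))
    · have h1 : Primrec fun p : Symbol × (Fin 2 × Bool) => p.1.1 := Primrec.fst.comp Primrec.fst
      exact (Primrec.cond (Primrec.snd.comp Primrec.snd) (Primrec.succ.comp h1)
        (Primrec.pred.comp h1)).pair (Primrec.snd.comp Primrec.fst)
  exact Primrec.list_foldl (h := fun _ p => Symbol.step p.1 p.2) Primrec.id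
    (Primrec.list_length.pair ((Primrec.const []).pair (Primrec.const [])))
    (this.comp (Primrec.fst.comp Primrec.snd) (Primrec.snd.comp Primrec.snd))

/-- The decision procedure for vanishing of the coordinates `2 * n` and `2 * n + 1` of a sum of
signed central generators. -/
def CoordVanish (stage : ℕ → ℕ → Option Bool) (n : ℕ) (l : List (ℕ × Bool)) : Prop :=
  (l.count (2 * n + 1, true) = l.count (2 * n + 1, false) ∧
    l.count (2 * n + 2, true) = l.count (2 * n + 2, false)) ∨
  -- The bound loses nothing: a stage that matters satisfies `s + 1 ≤ |p| ≤ l.length`, where `p` is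
  -- the net exponent of generator `2 * n + 1`.
  ∃ s < l.length,
    (stage n s = some true ∧
      l.count (2 * n + 1, true) + (s + 1) * l.count (2 * n + 2, true) =
        l.count (2 * n + 1, false) + (s + 1) * l.count (2 * n + 2, false)) ∨
    (stage n s = some false ∧
      l.count (2 * n + 1, true) + (s + 1) * l.count (2 * n + 2, false) =
        l.count (2 * n + 1, false) + (s + 1) * l.count (2 * n + 2, true))

theorem primrecRel_coordVanish {stage : ℕ → ℕ → Option Bool} (h : Primrec₂ stage) :
    PrimrecRel (CoordVanish stage) := by
  have odd : Primrec fun n : ℕ => 2 * n + 1 := Primrec.nat_double_succ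
  have even : Primrec fun n : ℕ => 2 * n + 2 := Primrec.succ.comp odd
  have cnt {f : ℕ → ℕ} (hf : Primrec f) (b : Bool) :
      Primrec fun p : ℕ × List (ℕ × Bool) => p.2.count (f p.1, b) :=
    primrec_list_count.comp Primrec.snd ((hf.comp Primrec.fst).pair (Primrec.const b))
  have lin {f g : ℕ × List (ℕ × Bool) → ℕ} (hf : Primrec f) (hg : Primrec g) :
      Primrec fun q : ℕ × (ℕ × List (ℕ × Bool)) => f q.2 + (q.1 + 1) * g q.2 :=
    Primrec.nat_add.comp (hf.comp Primrec.snd)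
      (Primrec.nat_mul.comp (Primrec.succ.comp Primrec.fst) (hg.comp Primrec.snd))
  have stg (b : Bool) : PrimrecPred fun q : ℕ × (ℕ × List (ℕ × Bool)) =>
      stage q.2.1 q.1 = some b :=
    Primrec.eq.comp (h.comp (Primrec.fst.comp Primrec.snd) Primrec.fst) (Primrec.const _)
  refine PrimrecPred.or (PrimrecPred.and (Primrec.eq.comp (cnt odd _) (cnt odd _))
    (Primrec.eq.comp (cnt even _) (cnt even _))) ?_
  have hR : PrimrecRel fun (s : ℕ) (p : ℕ × List (ℕ × Bool)) =>
      (stage p.1 s = some true ∧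
        p.2.count (2 * p.1 + 1, true) + (s + 1) * p.2.count (2 * p.1 + 2, true) =
          p.2.count (2 * p.1 + 1, false) + (s + 1) * p.2.count (2 * p.1 + 2, false)) ∨
      (stage p.1 s = some false ∧
        p.2.count (2 * p.1 + 1, true) + (s + 1) * p.2.count (2 * p.1 + 2, false) =
          p.2.count (2 * p.1 + 1, false) + (s + 1) * p.2.count (2 * p.1 + 2, true)) :=
    PrimrecPred.or
      (PrimrecPred.and (stg true)
        (Primrec.eq.comp (lin (cnt odd _) (cnt even _)) (lin (cnt odd _) (cnt even _))))
      (PrimrecPred.and (stg false)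
        (Primrec.eq.comp (lin (cnt odd _) (cnt even _)) (lin (cnt odd _) (cnt even _))))
  exact (hR.exists_mem_list.comp (Primrec.list_range.comp
    (Primrec.list_length.comp Primrec.snd)) Primrec.id).of_eq fun p => by simp

/-- The decision procedure for triviality of a symbolic element whose shift started at `N`. -/
def Symbol.Trivial (stage : ℕ → ℕ → Option Bool) (σ : Symbol) (N : ℕ) : Prop :=
  σ.1 = N ∧ (∀ e ∈ σ.2.1, σ.2.1.count (e.1, true) = σ.2.1.count (e.1, false)) ∧
    -- Indices `2n+1` and `2n+2` both fall in block `n`. Index `0` is sent to block `0` by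
    -- truncation, harmlessly, since an extra block is tested at most.
    ∀ e ∈ σ.2.2, CoordVanish stage ((e.1 - 1) / 2) σ.2.2

theorem Symbol.primrecRel_trivial {stage : ℕ → ℕ → Option Bool} (h : Primrec₂ stage) :
    PrimrecRel (Symbol.Trivial stage) := by
  refine PrimrecPred.and (Primrec.eq.comp (Primrec.fst.comp Primrec.fst) Primrec.snd)
    (PrimrecPred.and ?_ ?_)
  · have hR : PrimrecRel fun (e : ℕ × Bool) (l : List (ℕ × Bool)) =>
        l.count (e.1, true) = l.count (e.1, false) := by
      have cnt (b : Bool) : Primrec fun p : (ℕ × Bool) × List (ℕ × Bool) =>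
          p.2.count (p.1.1, b) :=
        primrec_list_count.comp Primrec.snd
          ((Primrec.fst.comp Primrec.fst).pair (Primrec.const b))
      exact Primrec.eq.comp (cnt _) (cnt _)
    have hl : Primrec fun p : Symbol × ℕ => p.1.2.1 :=
      Primrec.fst.comp (Primrec.snd.comp Primrec.fst)
    exact hR.forall_mem_list.comp hl hl
  · have hR : PrimrecRel fun (e : ℕ × Bool) (l : List (ℕ × Bool)) =>
        CoordVanish stage ((e.1 - 1) / 2) l :=
      (primrecRel_coordVanish h).comp (Primrec.nat_div.comp
        (Primrec.pred.comp (Primrec.fst.comp Primrec.fst)) (Primrec.const 2)) Primrec.snd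
    have hl : Primrec fun p : Symbol × ℕ => p.1.2.2 :=
      Primrec.snd.comp (Primrec.snd.comp Primrec.fst)
    exact hR.forall_mem_list.comp hl hl

end HallGroup

/-! ### Correctness of the symbolic evaluation. -/

/-- The sign attached to a Boolean exponent. -/
def Bool.sign (b : Bool) : ℤ := bif b then 1 else -1

theorem Bool.sign_beq (a b : Bool) : (a == b).sign = a.sign * b.sign := by
  cases a <;> cases b <;> rfl

theorem List.sum_map_sign_mul_ite (l : List (ℕ × Bool)) (k : ℕ) (c : ℤ) :
    (l.map fun e => e.2.sign * if e.1 = k then c else 0).sum =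
      ((l.count (k, true) : ℤ) - l.count (k, false)) * c := by
  induction l with
  | nil => simp
  | cons e l ih =>
    obtain ⟨j, b⟩ := e
    rw [List.map_cons, List.sum_cons, ih, List.count_cons, List.count_cons]
    by_cases h : j = k
    · cases b <;> simp [h, Bool.sign] <;> ring
    · simp [h]

theorem List.sum_map_sign_smul_apply {ι : Type*} (l : List (ℕ × Bool)) (f : ℕ → ι → ℤ) (i : ι) :
    (l.map fun e => e.2.sign • f e.1).sum i = (l.map fun e => e.2.sign * f e.1 i).sum := by
  induction l with
  | nil => rfl
  | cons e l ih =>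
    rw [List.map_cons, List.sum_cons, List.map_cons, List.sum_cons, Pi.add_apply, ih,
      Pi.smul_apply, smul_eq_mul]

namespace HallGroup

section Evaluation

variable {A : Type*} [AddCommGroup A] {d : ℕ → A}

/-- The element represented by a symbolic element whose shift started at `N`. -/
noncomputable def Symbol.eval (d : ℕ → A) (N : ℕ) (σ : Symbol) : HallGroup d :=
  ⟨σ.1 - N, (σ.2.1.map fun e => e.2.sign • T ((e.1 : ℤ) - N)).sum,
    (σ.2.2.map fun e => e.2.sign • d e.1).sum⟩

theorem letter_zero (h0 : d 0 = 0) (b : Bool) :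
    cond b (gen d 0) (gen d 0)⁻¹ = ⟨0, b.sign • 1, 0⟩ := by
  cases b
  · have : pairing d 1 = 0 := by rw [← T_zero, pairing_T]; simpa using h0
    ext1 <;> simp [Bool.sign, this]
  · ext1 <;> simp [Bool.sign]

theorem letter_one (b : Bool) : cond b (gen d 1) (gen d 1)⁻¹ = ⟨b.sign, 0, 0⟩ := by
  cases b
  · ext1 <;> simp [Bool.sign]
  · ext1 <;> simp [Bool.sign]

theorem pairing_sum_mul (l : List (ℕ × Bool)) (N m : ℕ) (b : Bool) :
    pairing d (invert (l.map fun e => e.2.sign • T ((e.1 : ℤ) - N)).sum *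
      (T ((m : ℤ) - N) * (b.sign • 1))) =
    (l.map fun e => (e.2 == b).sign • d (m - e.1)).sum := by
  induction l with
  | nil => simp
  | cons e l ih =>
    rw [List.map_cons, List.sum_cons, List.map_cons, List.sum_cons, map_add, add_mul, map_add, ih]
    congr 1
    have : invert (e.2.sign • T ((e.1 : ℤ) - N)) * (T ((m : ℤ) - N) * (b.sign • 1)) =
        (e.2 == b).sign • (T ((m : ℤ) - e.1) : ℤ[T;T⁻¹]) := by
      rw [map_zsmul, invert_T, mul_smul_comm, mul_one, smul_mul_smul_comm, ← T_add, Bool.sign_beq]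
      congr 2
      ring
    rw [this, map_zsmul, pairing_T]
    congr 2
    -- Truncated subtraction of naturals is `toNat` of the integer difference, matching how
    -- `pairing` treats negative exponents.
    omega

theorem Symbol.eval_step (h0 : d 0 = 0) (N : ℕ) {σ : Symbol} (hσ : 1 ≤ σ.1) (a : Fin 2 × Bool) :
    (σ.step a).eval d N = σ.eval d N * cond a.2 (gen d a.1) (gen d a.1)⁻¹ := by
  obtain ⟨i, b⟩ := a
  obtain ⟨m, l, z⟩ := σ
  fin_cases i
  · simp only [Fin.zero_eta, letter_zero h0]
    ext1
    · simp [Symbol.step, Symbol.eval]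
    · simp [Symbol.step, Symbol.eval, add_comm]
    · simp only [Symbol.step, Symbol.eval, mul_center, pairing_sum_mul]
      simp [add_comm, Function.comp_def]
  · simp only [Fin.mk_one, letter_one]
    ext1
    · cases b
      · simp only [Symbol.step, Symbol.eval, mul_shift, Bool.sign]
        simp at hσ ⊢
        omega
      · simp [Symbol.step, Symbol.eval, Bool.sign]
        ring
    · simp [Symbol.step, Symbol.eval]
    · simp [Symbol.step, Symbol.eval]

/-- A starting position at least the number of remaining letters ensures that no decrement of the
shift is truncated. -/
theorem Symbol.eval_foldl (h0 : d 0 = 0) (N : ℕ) (w : List (Fin 2 × Bool)) :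
    ∀ σ : Symbol, w.length ≤ σ.1 →
      (w.foldl Symbol.step σ).eval d N = σ.eval d N * wordVal (gen d) w := by
  induction w with
  | nil => intro σ _; simp [wordVal]
  | cons a w ih =>
    intro σ hσ
    rw [List.length_cons] at hσ
    have hstep : w.length ≤ (σ.step a).1 := by
      simp only [Symbol.step]
      split_ifs
      · simp only; omega
      · cases a.2 <;> simp only [cond_true, cond_false] <;> omega
    rw [List.foldl_cons, ih _ hstep, Symbol.eval_step h0 N (by omega), mul_assoc]
    simp [wordVal]

theorem Symbol.eval_ofWord (h0 : d 0 = 0) (w : List (Fin 2 × Bool)) :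
    (Symbol.ofWord w).eval d w.length = wordVal (gen d) w := by
  rw [Symbol.ofWord, Symbol.eval_foldl h0 _ _ _ le_rfl]
  have : Symbol.eval d w.length (w.length, [], []) = 1 := by ext1 <;> simp [Symbol.eval]
  rw [this, one_mul]

theorem sum_sign_smul_T_eq_zero_iff (l : List (ℕ × Bool)) (N : ℕ) :
    (l.map fun e => e.2.sign • (T ((e.1 : ℤ) - N) : ℤ[T;T⁻¹])).sum = 0 ↔
      ∀ e ∈ l, l.count (e.1, true) = l.count (e.1, false) := by
  have coeff_sum (l : List (ℕ × Bool)) (j : ℤ) :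
      (l.map fun e => e.2.sign • (T ((e.1 : ℤ) - N) : ℤ[T;T⁻¹])).sum.coeff j =
        (l.map fun e => e.2.sign * if (e.1 : ℤ) - N = j then 1 else 0).sum := by
    induction l with
    | nil => rfl
    | cons e l ih =>
      rw [List.map_cons, List.sum_cons, List.map_cons, List.sum_cons, AddMonoidAlgebra.coeff_add,
        Finsupp.add_apply, ih, AddMonoidAlgebra.coeff_smul, Finsupp.smul_apply, T_apply,
        smul_eq_mul]
  have coeff_sum' (k : ℕ) :
      (l.map fun e => e.2.sign • (T ((e.1 : ℤ) - N) : ℤ[T;T⁻¹])).sum.coeff ((k : ℤ) - N) =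
        (l.count (k, true) : ℤ) - l.count (k, false) := by
    rw [coeff_sum, ← mul_one ((l.count (k, true) : ℤ) - l.count (k, false)),
      ← List.sum_map_sign_mul_ite]
    simp
  constructor
  · intro h e _
    have := coeff_sum' e.1
    rw [h] at this
    simp at this
    omega
  · intro h
    ext j
    rw [AddMonoidAlgebra.coeff_zero, Finsupp.zero_apply]
    by_cases hj : ∃ e ∈ l, (e.1 : ℤ) - N = j
    · obtain ⟨e, he, rfl⟩ := hj
      rw [coeff_sum', h e he, sub_self]
    · push Not at hj
      rw [coeff_sum]
      exact List.sum_eq_zero fun x hx => by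
        obtain ⟨e, he, rfl⟩ := List.mem_map.1 hx
        simp [hj e he]

end Evaluation

/-! ### The commutator sequence and the word problem. -/

section Slope

variable (stage : ℕ → ℕ → Option Bool)

open Classical in
/-- The integer `±(s + 1)` if `n` is enumerated at stage `s`, and `0` if `n` is never enumerated. -/
noncomputable def slope (n : ℕ) : ℤ :=
  if h : ∃ p : ℕ × Bool, stage n p.1 = some p.2 then
    h.choose.2.sign * (h.choose.1 + 1) else 0

/-- The commutator sequence: `2 * n + 1` and `2 * n + 2` are sent to independent vectors if `n` is
never enumerated, and to a vector and its multiple by `slope stage n` otherwise. -/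
noncomputable def comm : ℕ → Lex (ℕ → ℤ)
  | 0 => 0
  | k + 1 => toLex <|
      if k % 2 = 0 then Pi.single k 1
      else if slope stage (k / 2) = 0 then Pi.single k 1
      else Pi.single (k - 1) (slope stage (k / 2))

theorem comm_zero : comm stage 0 = 0 := rfl

theorem comm_odd (n : ℕ) : comm stage (2 * n + 1) = toLex (Pi.single (2 * n) 1) := by
  simp [comm]

theorem comm_even (n : ℕ) : comm stage (2 * n + 2) =
    if slope stage n = 0 then toLex (Pi.single (2 * n + 1) 1)
    else toLex (Pi.single (2 * n) (slope stage n)) := by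
  have h : (2 * n + 1) / 2 = n := by omega
  have h' : (2 * n + 1) % 2 ≠ 0 := by omega
  rw [show 2 * n + 2 = (2 * n + 1) + 1 from rfl, comm, if_neg h', h, Nat.add_sub_cancel]
  split_ifs <;> rfl

theorem comm_even_of_slope_ne_zero {n : ℕ} (h : slope stage n ≠ 0) :
    comm stage (2 * n + 2) = slope stage n • comm stage (2 * n + 1) := by
  rw [comm_even, if_neg h, comm_odd]
  have : (Pi.single (2 * n) (slope stage n) : ℕ → ℤ) = slope stage n • Pi.single (2 * n) 1 := by
    rw [← Pi.single_smul, smul_eq_mul, mul_one]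
  exact congrArg toLex this

theorem comm_ofLex_two_mul (k n : ℕ) : ofLex (comm stage k) (2 * n) =
    (if k = 2 * n + 1 then 1 else 0) + if k = 2 * n + 2 then slope stage n else 0 := by
  rcases k with - | k
  · change (0 : ℤ) = _
    simp
  · obtain ⟨m, rfl | rfl⟩ : ∃ m, k = 2 * m ∨ k = 2 * m + 1 := ⟨k / 2, by omega⟩
    · rw [comm_odd]
      by_cases h : n = m
      · simp [h]
      · simp [h]
        omega
    · rw [comm_even]
      by_cases h : n = m
      · subst h
        split_ifs <;> simp_all
      · split_ifs <;> simp [Pi.single_apply] <;> omega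

theorem comm_ofLex_two_mul_add_one (k n : ℕ) : ofLex (comm stage k) (2 * n + 1) =
    if k = 2 * n + 2 then (if slope stage n = 0 then 1 else 0) else 0 := by
  rcases k with - | k
  · change (0 : ℤ) = _
    simp
  · obtain ⟨m, rfl | rfl⟩ : ∃ m, k = 2 * m ∨ k = 2 * m + 1 := ⟨k / 2, by omega⟩
    · rw [comm_odd]
      simp [Pi.single_apply]
      omega
    · rw [comm_even]
      by_cases h : n = m
      · subst h
        split_ifs <;> simp_all
      · split_ifs <;> simp [Pi.single_apply] <;> omega

variable {stage}

theorem slope_eq (hst : IsInseparableEnumeration stage) {n s : ℕ} {b : Bool}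
    (h : stage n s = some b) : slope stage n = b.sign * (s + 1) := by
  have hex : ∃ p : ℕ × Bool, stage n p.1 = some p.2 := ⟨(s, b), h⟩
  have e : hex.choose.1 = s := hst.unique (n := n) (by simp [hex.choose_spec]) (by simp [h])
  have e' : hex.choose.2 = b := by
    have := hex.choose_spec
    rw [e, h] at this
    exact (Option.some.inj this).symm
  rw [slope, dif_pos hex, e, e']

theorem slope_eq_zero {n : ℕ} (h : ∀ s b, stage n s ≠ some b) : slope stage n = 0 := by
  rw [slope, dif_neg]
  rintro ⟨p, hp⟩
  exact h _ _ hp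

theorem slope_ne_zero (hst : IsInseparableEnumeration stage) {n s : ℕ} {b : Bool}
    (h : stage n s = some b) : slope stage n ≠ 0 := by
  rw [slope_eq hst h]
  cases b <;> simp [Bool.sign] <;> omega

/-- With net exponents `p`, `q` of generators `2n+1`, `2n+2`, the two coordinates are `p + q *
slope` and, when the slope is zero, `q` (otherwise `0`). -/
theorem coordVanish_iff (hst : IsInseparableEnumeration stage) (n : ℕ) (l : List (ℕ × Bool)) :
    CoordVanish stage n l ↔
      ofLex (l.map fun e => e.2.sign • comm stage e.1).sum (2 * n) = 0 ∧
      ofLex (l.map fun e => e.2.sign • comm stage e.1).sum (2 * n + 1) = 0 := by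
  have hp : ((l.count (2 * n + 1, true) : ℤ) - l.count (2 * n + 1, false)).natAbs ≤ l.length := by
    have := List.count_le_length (a := (2 * n + 1, true)) (l := l)
    have := List.count_le_length (a := (2 * n + 1, false)) (l := l)
    omega
  have h1 : ofLex (l.map fun e => e.2.sign • comm stage e.1).sum (2 * n) =
      ((l.count (2 * n + 1, true) : ℤ) - l.count (2 * n + 1, false)) +
      ((l.count (2 * n + 2, true) : ℤ) - l.count (2 * n + 2, false)) * slope stage n := by
    rw [← mul_one ((l.count (2 * n + 1, true) : ℤ) - l.count (2 * n + 1, false)),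
      ← List.sum_map_sign_mul_ite, ← List.sum_map_sign_mul_ite, ← List.sum_map_add]
    refine (List.sum_map_sign_smul_apply l (fun k => ofLex (comm stage k)) _).trans ?_
    simp only [comm_ofLex_two_mul, mul_add]
  have h2 : ofLex (l.map fun e => e.2.sign • comm stage e.1).sum (2 * n + 1) =
      ((l.count (2 * n + 2, true) : ℤ) - l.count (2 * n + 2, false)) *
        if slope stage n = 0 then 1 else 0 := by
    rw [← List.sum_map_sign_mul_ite]
    refine (List.sum_map_sign_smul_apply l (fun k => ofLex (comm stage k)) _).trans ?_
    simp only [comm_ofLex_two_mul_add_one]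
  rw [h1, h2]
  simp only [CoordVanish]
  generalize l.count (2 * n + 1, true) = a at *
  generalize l.count (2 * n + 1, false) = a' at *
  generalize l.count (2 * n + 2, true) = c at *
  generalize l.count (2 * n + 2, false) = c' at *
  constructor
  · rintro (⟨rfl, rfl⟩ | ⟨s, -, ⟨hs, h⟩ | ⟨hs, h⟩⟩)
    · simp
    · rw [if_neg (slope_ne_zero hst hs), slope_eq hst hs]
      zify at h
      exact ⟨by simp only [Bool.sign, cond_true]; linear_combination h, by simp⟩
    · rw [if_neg (slope_ne_zero hst hs), slope_eq hst hs]
      zify at h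
      exact ⟨by simp only [Bool.sign, cond_false]; linear_combination h, by simp⟩
  · rintro ⟨e1, e2⟩
    by_cases hex : ∃ s b, stage n s = some b
    · obtain ⟨s, b, hs⟩ := hex
      rw [slope_eq hst hs] at e1
      by_cases hc : c = c'
      · left
        rw [hc] at e1
        simp at e1
        exact ⟨by omega, hc⟩
      · right
        -- Here `q ≠ 0`, so `p` is a nonzero multiple of `s + 1`, while `|p|` is at most the length
        -- of the list.
        have hs' : s < l.length := by
          have hdvd : ((s : ℤ) + 1) ∣ (a : ℤ) - a' := by
            refine ⟨-(((c : ℤ) - c') * b.sign), ?_⟩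
            linear_combination e1
          have hne : (a : ℤ) - a' ≠ 0 := by
            intro h
            rw [h, zero_add, mul_eq_zero, mul_eq_zero] at e1
            rcases e1 with h | h | h
            · omega
            · cases b <;> simp [Bool.sign] at h
            · omega
          have := Int.natAbs_le_of_dvd_ne_zero hdvd hne
          omega
        refine ⟨s, hs', ?_⟩
        cases b
        · right
          refine ⟨hs, ?_⟩
          zify
          simp only [Bool.sign, cond_false] at e1
          linear_combination e1
        · left
          refine ⟨hs, ?_⟩
          zify
          simp only [Bool.sign, cond_true] at e1
          linear_combination e1
    · push Not at hex
      rw [slope_eq_zero hex] at e1 e2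
      simp at e1 e2
      left
      omega

theorem sum_sign_smul_comm_eq_zero_iff (hst : IsInseparableEnumeration stage)
    (l : List (ℕ × Bool)) : (l.map fun e => e.2.sign • comm stage e.1).sum = 0 ↔
      ∀ e ∈ l, CoordVanish stage ((e.1 - 1) / 2) l := by
  constructor
  · intro h e _
    rw [coordVanish_iff hst, h]
    exact ⟨rfl, rfl⟩
  · intro h
    have key (n : ℕ) : CoordVanish stage n l := by
      by_cases hn : ∃ e ∈ l, (e.1 - 1) / 2 = n
      · obtain ⟨e, he, rfl⟩ := hn
        exact h e he
      -- A block with no index in the list has all counts zero.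
      · push Not at hn
        left
        have h1 (b : Bool) : l.count (2 * n + 1, b) = 0 :=
          List.count_eq_zero.2 fun hm => hn _ hm (by simp)
        have h2 (b : Bool) : l.count (2 * n + 2, b) = 0 :=
          List.count_eq_zero.2 fun hm => hn _ hm (by simp; omega)
        simp [h1, h2]
    apply ofLex.injective
    funext i
    obtain ⟨n, rfl | rfl⟩ : ∃ n, i = 2 * n ∨ i = 2 * n + 1 := ⟨i / 2, by omega⟩
    · exact ((coordVanish_iff hst n l).1 (key n)).1
    · exact ((coordVanish_iff hst n l).1 (key n)).2

theorem Symbol.trivial_iff (hst : IsInseparableEnumeration stage) (σ : Symbol) (N : ℕ) :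
    σ.Trivial stage N ↔ σ.eval (comm stage) N = 1 := by
  rw [HallGroup.ext_iff]
  simp only [Symbol.Trivial, Symbol.eval, one_shift, one_poly, one_center,
    sum_sign_smul_T_eq_zero_iff, sum_sign_smul_comm_eq_zero_iff hst]
  rw [sub_eq_zero, Nat.cast_inj]

theorem computablePred_wordVal_gen (hst : IsInseparableEnumeration stage) :
    ComputablePred fun w : List (Fin 2 × Bool) => wordVal (gen (comm stage)) w = 1 := by
  refine PrimrecPred.computablePred (((Symbol.primrecRel_trivial hst.primrec).comp
    Symbol.primrec_ofWord Primrec.list_length).of_eq fun w => ?_)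
  rw [Symbol.trivial_iff hst, Symbol.eval_ofWord (comm_zero stage)]

end Slope

end HallGroup

/-! ### Words, computable relations and signs in p-orders. -/

section Words

variable {ι G : Type*} [Group G] (x : ι → G)

theorem wordVal_append (u v : List (ι × Bool)) : wordVal x (u ++ v) = wordVal x u * wordVal x v := by
  simp [wordVal]

theorem wordVal_flatten_replicate (k : ℕ) (w : List (ι × Bool)) :
    wordVal x (List.replicate k w).flatten = wordVal x w ^ k := by
  induction k with
  | zero => rw [pow_zero]; rfl
  | succ k ih => rw [List.replicate_succ, List.flatten_cons, wordVal_append, ih, pow_succ']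

theorem exists_wordVal_eq {x : ι → G} (hx : Subgroup.closure (Set.range x) = ⊤) (g : G) :
    ∃ w, wordVal x w = g := by
  have hg : g ∈ Subgroup.closure (Set.range x) := hx ▸ Subgroup.mem_top g
  induction hg using Subgroup.closure_induction_right with
  | one => exact ⟨[], rfl⟩
  | mul_right g _ y hy ih =>
    obtain ⟨w, rfl⟩ := ih
    obtain ⟨i, rfl⟩ := hy
    exact ⟨w ++ [(i, true)], by simp [wordVal]⟩
  | mul_inv_cancel g _ y hy ih =>
    obtain ⟨w, rfl⟩ := ih
    obtain ⟨i, rfl⟩ := hy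
    exact ⟨w ++ [(i, false)], by simp [wordVal]⟩

theorem map_wordVal {H : Type*} [Group H] (f : G →* H) (w : List (ι × Bool)) :
    f (wordVal x w) = wordVal (fun i => f (x i)) w := by
  rw [wordVal, wordVal, map_list_prod, List.map_map]
  congr 2
  funext p
  cases h : p.2 <;> simp [h]

/-- Positivity of the commutators of `a` with `b ^ k * a * b⁻¹ ^ k` is decidable in `k` for a
computable relation. -/
theorem IsComputableRelWith.computablePred_commutator {H : Type*} [Group H] {y : ℕ → H}
    {r : H → H → Prop} (hr : IsComputableRelWith y r) (a b : H) :
    ComputablePred fun k : ℕ => r 1 ⁅a, b ^ k * a * (b ^ k)⁻¹⁆ := by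
  obtain ⟨hy, _, hr⟩ := hr
  obtain ⟨p, hp⟩ := exists_wordVal_eq hy a
  obtain ⟨p', hp'⟩ := exists_wordVal_eq hy a⁻¹
  obtain ⟨q, hq⟩ := exists_wordVal_eq hy b
  obtain ⟨q', hq'⟩ := exists_wordVal_eq hy b⁻¹
  let pow (w : List (ℕ × Bool)) (k : ℕ) : List (ℕ × Bool) := (List.replicate k w).flatten
  have pow_prim (w : List (ℕ × Bool)) : Primrec (pow w) := by
    refine (Primrec.list_flatten.comp (Primrec.list_map Primrec.list_range
      (Primrec₂.const w))).of_eq fun k => ?_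
    rw [List.map_const', List.length_range]
  have hw : Primrec fun k => p ++ (pow q k ++ (p ++ (pow q' k ++ (p' ++
      (pow q k ++ (p' ++ pow q' k)))))) :=
    Primrec.list_append.comp (Primrec.const p) <| Primrec.list_append.comp (pow_prim q) <|
    Primrec.list_append.comp (Primrec.const p) <| Primrec.list_append.comp (pow_prim q') <|
    Primrec.list_append.comp (Primrec.const p') <| Primrec.list_append.comp (pow_prim q) <|
    Primrec.list_append.comp (Primrec.const p') (pow_prim q')
  refine (hr.comp ((Primrec.const []).pair hw).to_comp).computablePred.of_eq fun k => ?_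
  simp only [wordVal_append, pow, wordVal_flatten_replicate, hp, hp', hq, hq']
  rw [commutatorElement_def]
  have : wordVal y [] = 1 := rfl
  rw [this]
  simp only [mul_inv_rev, inv_inv, inv_pow, mul_assoc]

end Words

namespace IsPOrder

variable {G : Type*} [Group G] {r : G → G → Prop}

theorem one_le_inv_iff (h : IsPOrder r) {g : G} (hg : g ≠ 1) : r 1 g⁻¹ ↔ ¬ r 1 g := by
  refine ⟨fun h1 h2 => hg ?_, fun h1 => (h.one_le_or_one_le_inv g).resolve_left h1⟩
  have := h.inv_le_one _ h1
  rw [inv_inv] at this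
  exact h.antisymm _ _ this h2

/-- If `g` is not positive then `g⁻¹` is, hence so is its `n`-th power, and a nontrivial element
cannot be positive together with its inverse. -/
theorem one_le_pow_iff (h : IsPOrder r) {g : G} {n : ℕ} (hg : g ^ n ≠ 1) :
    r 1 (g ^ n) ↔ r 1 g := by
  refine ⟨fun h1 => ?_, h.one_le_pow g n⟩
  by_contra h2
  have h3 := h.one_le_pow _ n ((h.one_le_or_one_le_inv g).resolve_left h2)
  rw [inv_pow] at h3
  exact (h.one_le_inv_iff hg).1 h3 h1

end IsPOrder

/-! ### Non-embeddability, derived length and the main theorem. -/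

namespace HallGroup

variable {stage : ℕ → ℕ → Option Bool}

theorem comm_even_ne_zero (n : ℕ) : comm stage (2 * n + 2) ≠ 0 := fun h => by
  rw [comm_even] at h
  split_ifs at h with h'
  · have := congrArg (fun z : Lex (ℕ → ℤ) => ofLex z (2 * n + 1)) h
    simp only [ofLex_toLex, Pi.single_eq_same] at this
    exact one_ne_zero this
  · have := congrArg (fun z : Lex (ℕ → ℤ) => ofLex z (2 * n)) h
    simp only [ofLex_toLex, Pi.single_eq_same] at this
    exact h' this

theorem two_smul_comm_two_sub_ne_zero :
    2 • comm stage 2 - comm stage 1 - comm stage 3 ≠ 0 := fun h => by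
  -- At coordinate `2` only `comm stage 3` is nonzero among the three terms, whatever the slopes
  -- are.
  have h1 : 2 * ofLex (comm stage 2) (2 * 1) - ofLex (comm stage 1) (2 * 1) -
      ofLex (comm stage 3) (2 * 1) = 0 := by
    have := congrArg (fun z : Lex (ℕ → ℤ) => ofLex z (2 * 1)) h
    rw [two_nsmul] at this
    rw [two_mul]
    exact this
  simp only [comm_ofLex_two_mul] at h1
  norm_num at h1

/-- A commutator sequence built from recursively inseparable sets prevents computable p-orders. -/
theorem not_exists_injective_of_hasComputablePOrder (hst : IsInseparableEnumeration stage)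
    {K : Subgroup (HallGroup (comm stage))} (hK : Set.range (gen (comm stage)) ⊆ K)
    {H : Type*} [Group H] (hH : HasComputablePOrder H) :
    ¬ ∃ f : K →* H, Function.Injective f := by
  rintro ⟨f, hf⟩
  obtain ⟨r, y, hr, hy⟩ := hH
  let a : K := ⟨gen _ 0, hK ⟨0, rfl⟩⟩
  let b : K := ⟨gen _ 1, hK ⟨1, rfl⟩⟩
  let c (k : ℕ) : K := ⁅a, b ^ k * a * (b ^ k)⁻¹⁆
  have hc (k : ℕ) : (c k : HallGroup (comm stage)) = incl _ (.ofAdd (comm stage k)) :=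
    commutatorElement_gen (comm_zero stage) k
  have c_ne_one {k : ℕ} (hk : comm stage k ≠ 0) : f (c k) ≠ 1 := by
    rw [Ne, map_eq_one_iff f hf, ← OneMemClass.coe_eq_one, hc, map_eq_one_iff _ incl_injective]
    exact hk
  have c_even {n : ℕ} (h : slope stage n ≠ 0) :
      f (c (2 * n + 2)) = f (c (2 * n + 1)) ^ slope stage n := by
    rw [← map_zpow]
    congr 1
    apply Subtype.ext
    rw [SubgroupClass.coe_zpow, hc, hc, comm_even_of_slope_ne_zero stage h, ofAdd_zsmul, map_zpow]
  have hcomp := hy.computablePred_commutator (f a) (f b)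
  obtain ⟨g, hg, hg'⟩ := ComputablePred.computable_iff.1 hcomp
  have hg'' (k : ℕ) : r 1 (f (c k)) ↔ g k = true := by
    have := congrFun hg' k
    simp only [c, map_commutatorElement, map_mul, map_inv, map_pow]
    exact iff_of_eq this
  have hodd : Computable fun n : ℕ => g (2 * n + 1) :=
    hg.comp Primrec.nat_double_succ.to_comp
  have heven : Computable fun n : ℕ => g (2 * n + 2) :=
    hg.comp (Primrec.succ.comp Primrec.nat_double_succ).to_comp
  -- The candidate separator asks whether the two commutators of block `n` have the same sign. At
  -- the `n` where it errs, equal signs meet a negative multiplier or different signs a positive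
  -- one.
  obtain ⟨n, s, hs⟩ := hst.inseparable (fun n => g (2 * n + 1) == g (2 * n + 2))
    (Primrec.beq.to_comp.comp hodd heven)
  have e := c_even (slope_ne_zero hst hs)
  have hne := c_ne_one (comm_even_ne_zero (stage := stage) n)
  rw [slope_eq hst hs] at e
  have cast : ((s : ℤ) + 1) = ((s + 1 : ℕ) : ℤ) := by push_cast; rfl
  by_cases hb : g (2 * n + 1) = g (2 * n + 2)
  · have e' : f (c (2 * n + 2)) = (f (c (2 * n + 1)) ^ (s + 1))⁻¹ := by
      rw [e, hb, beq_self_eq_true, cast]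
      simp only [Bool.not_true, Bool.sign, cond_false, neg_one_mul, zpow_neg, zpow_natCast]
    rw [e', Ne, inv_eq_one] at hne
    have := hg'' (2 * n + 2)
    rw [e', hr.one_le_inv_iff hne, hr.one_le_pow_iff hne, hg'', hb] at this
    exact not_iff_self this
  · have e' : f (c (2 * n + 2)) = f (c (2 * n + 1)) ^ (s + 1) := by
      rw [e, beq_eq_false_iff_ne.2 hb, cast]
      simp only [Bool.not_false, Bool.sign, cond_true, one_mul, zpow_natCast]
    rw [e'] at hne
    have := hg'' (2 * n + 2)
    rw [e', hr.one_le_pow_iff hne, hg'', Bool.coe_iff_coe] at this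
    exact hb this

theorem hasDerivedLength_three {K : Subgroup (HallGroup (comm stage))}
    (hK : Set.range (gen (comm stage)) ⊆ K) : HasDerivedLength K 3 := by
  constructor
  · rw [eq_bot_iff, ← Subgroup.map_le_map_iff_of_injective K.subtype_injective, Subgroup.map_bot,
      ← derivedSeries_three (d := comm stage)]
    exact map_derivedSeries_le_derivedSeries K.subtype 3
  · intro m hm hbot
    let a : K := ⟨gen _ 0, hK ⟨0, rfl⟩⟩
    let b : K := ⟨gen _ 1, hK ⟨1, rfl⟩⟩
    have h1 : ⁅b, a⁆ ∈ derivedSeries K 1 := by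
      rw [derivedSeries_succ, derivedSeries_zero]
      exact Subgroup.commutator_mem_commutator (Subgroup.mem_top _) (Subgroup.mem_top _)
    have h2 : ⁅⁅b, a⁆, b ^ 2 * ⁅b, a⁆ * (b ^ 2)⁻¹⁆ ∈ derivedSeries K 2 :=
      Subgroup.commutator_mem_commutator h1 ((derivedSeries_normal K 1).conj_mem _ h1 _)
    have h3 := derivedSeries_antitone K (show m ≤ 2 by omega) h2
    rw [hbot, Subgroup.mem_bot, ← OneMemClass.coe_eq_one] at h3
    have h4 := (commutatorElement_commutatorElement_gen (comm_zero stage) 1).symm.trans h3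
    rw [map_eq_one_iff _ incl_injective] at h4
    exact two_smul_comm_two_sub_ne_zero h4

end HallGroup

theorem IsBiorderable.subgroup {G : Type*} [Group G] (h : IsBiorderable G) (K : Subgroup G) :
    IsBiorderable K := by
  obtain ⟨_, h⟩ := h
  exact ⟨inferInstance, fun a b c hab => h a b c hab⟩

theorem theorem1 :
    ∃ (G : Type) (_ : Group G),
      (∃ x : Fin 2 → G, IsComputableGroupWith x) ∧
      IsBiorderable G ∧
      HasDerivedLength G 3 ∧
      ∀ (H : Type*) [Group H] [Countable H], HasComputablePOrder H →
        ¬ ∃ f : G →* H, Function.Injective f := by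
  obtain ⟨stage, hst⟩ := exists_isInseparableEnumeration
  -- The whole Hall group has the uncountable central subgroup `ℕ → ℤ`, so the two-generated
  -- subgroup is taken instead.
  let K := Subgroup.closure (Set.range (HallGroup.gen (HallGroup.comm stage)))
  have hK : Set.range (HallGroup.gen (HallGroup.comm stage)) ⊆ K := Subgroup.subset_closure
  let x : Fin 2 → K := fun i => ⟨HallGroup.gen _ i, hK ⟨i, rfl⟩⟩
  refine ⟨K, inferInstance, ⟨x, ?_, ?_⟩, HallGroup.isBiorderable.subgroup K,
    HallGroup.hasDerivedLength_three hK,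
    fun H _ _ hH => HallGroup.not_exists_injective_of_hasComputablePOrder hst hK hH⟩
  · rw [← Subgroup.closure_closure_coe_preimage (k := Set.range (HallGroup.gen _))]
    congr 1
    ext g
    simp [x, Subtype.ext_iff]
  · refine (HallGroup.computablePred_wordVal_gen hst).of_eq fun w => ?_
    rw [← OneMemClass.coe_eq_one]
    exact iff_of_eq (congrArg (· = 1) (map_wordVal x K.subtype w).symm)
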